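/- **Theorem (geometric convergence of Lie group spectral variational integrators).** Let $G$ be a Lie group with Lie algebra $\mathfrak g$, let $|\cdot|=\langle\cdot,\cdot\rangle^{1/2}$ be the norm of an inner product on $\mathfrak g$, let $L:TG\to\mathbb R$ be a $C^2$ Lagrangian and fix $h>0$. Let $\Phi:\mathfrak g\to G$ be a map that is a local diffeomorphism on an open set $U\subseteq\mathfrak g$. For every $n$ let $\phi^n_1,\dots,\phi^n_n\in C^2([0,h])$, let $A_n=\{\sum_i\xi^i\phi^n_i:\xi^i\in\mathfrak g\}$, and let $\mathcal G_n(f)=h\sum_{j=1}^{m_n}b^n_jf(c^n_jh)$, $c^n_j\in[0,1]$, be a quadrature rule on $[0,h]$. For $g_0,g_1\in G$ let $A_n(g_0,g_1)$ be the set of $\eta\in A_n$ with $\eta([0,h])\subset U$, $g_0\Phi(\eta(0))=g_0$ and $g_0\Phi(\eta(h))=g_1$. Let $W\subseteq G\times G$ (for instance a single pair), $V\subseteq TG$ (for instance $V=TG$) and $n_0\in\mathbb N$. Suppose that for every $(g_0,g_1)\in W$ there is given a solution $\bar g(t)=g_0\Phi(\bar\xi(t))$ of the Euler–Lagrange equations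 on $[0,h]$ from $g_0$ to $g_1$, with $\bar\xi\in C^2([0,h],U)$ and $(\bar g,\dot{\bar g})\in V$ on $[0,h]$, and, for every $n\ge n_0$, a stationary curve $\tilde g_n=g_0\Phi(\tilde\xi_n)$, $\tilde\xi_n\in A_n(g_0,g_1)$, of the discrete action $g\mapsto h\sum_jb^n_jL(g(c^n_jh),\dot g(c^n_jh))$ over $\{g_0\Phi(\eta):\eta\in A_n(g_0,g_1)\}$. Put $$L_d^E(g_0,g_1)=\int_0^hL(\bar g,\dot{\bar g})\,dt,\qquad L_{d,n}(g_0,g_1)=h\sum_{j=1}^{m_n}b^n_jL(\tilde g_n(c^n_jh),\dot{\tilde g}_n(c^n_jh)).$$ Suppose that there are nonnegative constants $C_A,C_A',C_L,C_G,C_V,C_{VG},C_Q$ and $K,K_q\in(0,1)$, independent of $n$ and of $(g_0,g_1)\in W$, and functions $e_G:G\times G\to\mathbb R$, $e_A:TG\times TG\to\mathbb R$ such that 1. for all $n\ge n_0$ and $(g_0,g_1)\in W$ there is $\hat\xi_n\in A_n(g_0,g_1)$, whose curve $\hat g_n=g_0\Phi(\hat\xi_n)$ satisfies $(\hat g_n,\dot{\hat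 g}_n)\in V$ on $[0,h]$, with $|\bar\xi-\hat\xi_n|\le C_AK^n$ and $|\dot{\bar\xi}-\dot{\hat\xi}_n|\le C_A'K^n$ on $[0,h]$; 2. $|L(g_1,\dot g_1)-L(g_2,\dot g_2)|\le C_L\,(e_G(g_1,g_2)+e_A(\dot g_1,\dot g_2))$ on $V$; 3. for every $g_0$ that is the first member of a pair in $W$, and all $\xi,\eta\in C^2([0,h],U)$ such that the curves $g_0\Phi(\xi),g_0\Phi(\eta)$ and their velocities stay in $V$: $e_G(g_0\Phi(\xi),g_0\Phi(\eta))\le C_G|\xi-\eta|$ and $e_A(\tfrac{d}{dt}g_0\Phi(\xi),\tfrac{d}{dt}g_0\Phi(\eta))\le C_V|\dot\xi-\dot\eta|+C_{VG}|\xi-\eta|$ on $[0,h]$; 4. for every $n\ge n_0$, every such $g_0$ and every $g=g_0\Phi(\eta)$ with $\eta\in A_n$, $\eta([0,h])\subset U$: $\bigl|\int_0^hL(g,\dot g)\,dt-h\sum_jb^n_jL(g(c^n_jh),\dot g(c^n_jh))\bigr|\le C_QK_q^n$; 5. $\bar g$ minimizes the action among $C^2$ curves $[0,h]\to G$ with the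 same endpoints, and $\tilde g_n$ minimizes the discrete action over $\{g_0\Phi(\eta):\eta\in A_n(g_0,g_1)\}$. Let $\tilde K=\max(K,K_q)<1$. Then: (a) There is $C$ such that $|L_d^E(g_0,g_1)-L_{d,n}(g_0,g_1)|\le C\tilde K^n$ for all $n\ge n_0$ and $(g_0,g_1)\in W$. (b) The variational integrator induced by $L_{d,n}$ has error $O(\tilde K^n)$, in the following sense. Let $q$ be a $C^2$ solution of the Euler–Lagrange equations on $[0,2h]$ such that $(q(0),q(h))$ and $(q(h),q(2h))$ are interior points of $W$ and $q|_{[0,h]}$, $q|_{[h,2h]}$ are the given exact solutions for these two pairs (the second one after the time shift by $h$). Suppose that near these two pairs $L_d^E$ is $C^2$ and the remainders $e_n$ in $L_{d,n}=L_d^E+\tilde K^ne_n$ are differentiable, with differentials that are, in charts, Lipschitz uniformly in $n\ge n_0$ (as when their second derivatives are bounded uniformly in $n$), and that the mixed second derivative $D_2D_1L_d^E$ is nondegenerate at $(q(h),q(2h))$. Then there are a neighbourhood $N$ of $q(2h)$ and constants $C,n_1$ such that for all $n\ge n_1$ the discrete Euler–Lagrange equation $D_2L_{d,n}(q(0),q(h))+D_1L_{d,n}(q(h),y)=0$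 has exactly one solution $y=y_n$ in $N$, and, in the chart of $G$ at $q(2h)$, $|y_n-q(2h)|\le C\tilde K^n$. -/

import Mathlib

open Set Filter Topology
open scoped Manifold ContDiff NNReal

namespace LieGalerkin

noncomputable section

/-! Throughout, `G` is a Lie group modelled on the finite-dimensional inner product space `E`, so that
`E` is (definitionally) the tangent space of `G` at the identity, i.e. the Lie algebra of `G`, and
the inner product of `E` is the chosen metric on the Lie algebra. -/

variable {E : Type*} [NormedAddCommGroup E] [InnerProductSpace ℝ E]
  {G : Type*} [TopologicalSpace G] [ChartedSpace E G]

/-- A `C²` curve `[0,T] → G`. -/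
def IsC2Curve (E : Type*) [NormedAddCommGroup E] [InnerProductSpace ℝ E]
    {G : Type*} [TopologicalSpace G] [ChartedSpace E G] (T : ℝ) (g : ℝ → G) : Prop :=
  ContMDiffOn 𝓘(ℝ, ℝ) 𝓘(ℝ, E) 2 g (Icc 0 T)

/-- The point `(g(t), ġ(t))` of `TG`, for a curve `g` on `[0,T]` (one-sided derivatives at the
endpoints). -/
def lift (E : Type*) [NormedAddCommGroup E] [InnerProductSpace ℝ E]
    {G : Type*} [TopologicalSpace G] [ChartedSpace E G] (T : ℝ) (g : ℝ → G) (t : ℝ) :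
    TangentBundle 𝓘(ℝ, E) G :=
  ⟨g t, mfderivWithin 𝓘(ℝ, ℝ) 𝓘(ℝ, E) g (Icc 0 T) t (1 : ℝ)⟩

/-- The action `∫₀ᵀ L(g, ġ) dt`. -/
def action (L : TangentBundle 𝓘(ℝ, E) G → ℝ) (T : ℝ) (g : ℝ → G) : ℝ :=
  ∫ t in (0 : ℝ)..T, L (lift E T g t)

/-- `Γ` is a `C²` variation, with fixed endpoints, of the curve `g` on `[0,T]`. -/
def IsVariation (E : Type*) [NormedAddCommGroup E] [InnerProductSpace ℝ E]
    {G : Type*} [TopologicalSpace G] [ChartedSpace E G]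
    (T : ℝ) (g : ℝ → G) (Γ : ℝ → ℝ → G) : Prop :=
  ∃ ε > 0, ContMDiffOn 𝓘(ℝ, ℝ × ℝ) 𝓘(ℝ, E) 2 (fun p : ℝ × ℝ => Γ p.1 p.2)
      (Ioo (-ε) ε ×ˢ Icc 0 T) ∧
    EqOn (Γ 0) g (Icc 0 T) ∧ ∀ s ∈ Ioo (-ε) ε, Γ s 0 = g 0 ∧ Γ s T = g T

/-- `g` is a `C²` solution of the Euler-Lagrange equations of `L` on `[0,T]`, in variational form
(Hamilton's principle): the action is stationary at `g` with respect to all `C²` variations with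
fixed endpoints. -/
def SolvesEulerLagrange (L : TangentBundle 𝓘(ℝ, E) G → ℝ) (T : ℝ) (g : ℝ → G) : Prop :=
  IsC2Curve E T g ∧
    ∀ Γ : ℝ → ℝ → G, IsVariation E T g Γ → HasDerivAt (fun s => action L T (Γ s)) 0 0

/-- Among `C²` curves `[0,T] → G` with the same endpoints, `g` minimizes the action. -/
def MinimizesAction (L : TangentBundle 𝓘(ℝ, E) G → ℝ) (T : ℝ) (g : ℝ → G) : Prop :=
  ∀ k : ℝ → G, IsC2Curve E T k → k 0 = g 0 → k T = g T → action L T g ≤ action L T k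

/-- The curve `t ↦ g₀ Φ(ξ(t))` on the group given, in the natural chart at `g₀`, by a curve `ξ` in
the Lie algebra. -/
def chartCurve [Group G] (Φ : E → G) (g₀ : G) (ξ : ℝ → E) (t : ℝ) : G :=
  g₀ * Φ (ξ t)

/-- Curves `∑ ξⁱ φᵢ(t)` in the Lie algebra spanned by the scalar basis functions `φᵢ`. -/
def algSpace (E : Type*) [NormedAddCommGroup E] [InnerProductSpace ℝ E]
    {n : ℕ} (φ : Fin n → ℝ → ℝ) : Set (ℝ → E) :=
  {ξ | ∃ a : Fin n → E, ξ = fun t => ∑ i, φ i t • a i}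

/-- Curves `ξ` in the approximation space, with values in the chart domain `U` on `[0,h]`. The
corresponding curves `g₀ Φ(ξ(t))` make up the Galerkin space on the group. -/
def admissible (U : Set E) (h : ℝ) {n : ℕ} (φ : Fin n → ℝ → ℝ) : Set (ℝ → E) :=
  {ξ | ξ ∈ algSpace E φ ∧ MapsTo ξ (Icc 0 h) U}

/-- The same, with the endpoint conditions `g(0) = g₀` and `g(h) = g₁` for `g = g₀ Φ(ξ)`. -/
def admissibleBetween [Group G] (Φ : E → G) (U : Set E) (h : ℝ) {n : ℕ} (φ : Fin n → ℝ → ℝ)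
    (g₀ g₁ : G) : Set (ℝ → E) :=
  {ξ | ξ ∈ admissible U h φ ∧ chartCurve Φ g₀ ξ 0 = g₀ ∧ chartCurve Φ g₀ ξ h = g₁}

/-- The discrete action `h ∑ⱼ bⱼ L(g(cⱼ h), ġ(cⱼ h))`. -/
def discreteAction (L : TangentBundle 𝓘(ℝ, E) G → ℝ) (h : ℝ) {m : ℕ} (b c : Fin m → ℝ)
    (g : ℝ → G) : ℝ :=
  h * ∑ j, b j * L (lift E h g (c j * h))

/-- `g₀ Φ(ξ)` is an extremizing curve of the discrete action in the Galerkin space with endpoints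
`g₀, g₁`: it is stationary under all variations of its coefficients fixing the endpoints. -/
def IsDiscreteExtremal [Group G] (L : TangentBundle 𝓘(ℝ, E) G → ℝ) (Φ : E → G) (U : Set E) (h : ℝ)
    {n : ℕ} (φ : Fin n → ℝ → ℝ) {m : ℕ} (b c : Fin m → ℝ) (g₀ g₁ : G) (ξ : ℝ → E) : Prop :=
  ξ ∈ admissibleBetween Φ U h φ g₀ g₁ ∧
    ∀ δ ∈ algSpace E φ, δ 0 = 0 → δ h = 0 →
      HasDerivAt (fun s : ℝ => discreteAction L h b c
        (chartCurve Φ g₀ (fun t => ξ t + s • δ t))) 0 0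

/-- `g₀ Φ(ξ)` minimizes the discrete action in the Galerkin space with endpoints `g₀, g₁`. -/
def MinimizesDiscreteAction [Group G] (L : TangentBundle 𝓘(ℝ, E) G → ℝ) (Φ : E → G) (U : Set E)
    (h : ℝ) {n : ℕ} (φ : Fin n → ℝ → ℝ) {m : ℕ} (b c : Fin m → ℝ) (g₀ g₁ : G) (ξ : ℝ → E) : Prop :=
  ∀ η ∈ admissibleBetween Φ U h φ g₀ g₁,
    discreteAction L h b c (chartCurve Φ g₀ ξ) ≤ discreteAction L h b c (chartCurve Φ g₀ η)

/-- The exact discrete Lagrangian `L_d^E(g₀, g₁)`: the action of the solution of the Euler-Lagrange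
equations that joins `g₀` to `g₁` in time `h`, here `g₀ Φ(ξ(g₀, g₁))`. -/
def exactLd [Group G] (L : TangentBundle 𝓘(ℝ, E) G → ℝ) (Φ : E → G) (h : ℝ)
    (ξ : G → G → ℝ → E) (g₀ g₁ : G) : ℝ :=
  action L h (chartCurve Φ g₀ (ξ g₀ g₁))

/-- The Galerkin discrete Lagrangian `L_d(g₀, g₁)`: the discrete action of the extremizing Galerkin
curve from `g₀` to `g₁`, here `g₀ Φ(ξ(g₀, g₁))`. -/
def galerkinLd [Group G] (L : TangentBundle 𝓘(ℝ, E) G → ℝ) (Φ : E → G) (h : ℝ)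
    {m : ℕ} (b c : Fin m → ℝ) (ξ : G → G → ℝ → E) (g₀ g₁ : G) : ℝ :=
  discreteAction L h b c (chartCurve Φ g₀ (ξ g₀ g₁))

/-- `D₁F(x, y)`, a linear form on `T_x G`. -/
def D₁ (E : Type*) [NormedAddCommGroup E] [InnerProductSpace ℝ E]
    {G : Type*} [TopologicalSpace G] [ChartedSpace E G] (F : G → G → ℝ) (x y : G) : E →L[ℝ] ℝ :=
  mfderiv 𝓘(ℝ, E) 𝓘(ℝ, ℝ) (fun z => F z y) x

/-- `D₂F(x, y)`, a linear form on `T_y G`. -/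
def D₂ (E : Type*) [NormedAddCommGroup E] [InnerProductSpace ℝ E]
    {G : Type*} [TopologicalSpace G] [ChartedSpace E G] (F : G → G → ℝ) (x y : G) : E →L[ℝ] ℝ :=
  mfderiv 𝓘(ℝ, E) 𝓘(ℝ, ℝ) (fun z => F x z) y

/-- The discrete Euler-Lagrange equations of a discrete Lagrangian `F` at `(x, y), (y, z)`. The
variational integrator induced by `F` is the update map `(x, y) ↦ (y, z)` that they define. -/
def DiscreteEulerLagrange (E : Type*) [NormedAddCommGroup E] [InnerProductSpace ℝ E]
    {G : Type*} [TopologicalSpace G] [ChartedSpace E G] (F : G → G → ℝ) (x y z : G) : Prop :=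
  D₂ E F x y + D₁ E F y z = 0

/-- The discrete Lagrangian `F` is regular at `(x, y)`: the mixed second derivative `D₂D₁F(x, y)` is
nondegenerate. -/
def IsRegularAt (E : Type*) [NormedAddCommGroup E] [InnerProductSpace ℝ E]
    {G : Type*} [TopologicalSpace G] [ChartedSpace E G] (F : G → G → ℝ) (x y : G) : Prop :=
  Function.Injective (mfderiv 𝓘(ℝ, E) 𝓘(ℝ, E →L[ℝ] ℝ) (fun z => D₁ E F x z) y)

/-- A function on `G × G` read in the charts of `G` at `a` and `b`. -/
def localRep (F : G → G → ℝ) (a b : G) (p : E × E) : ℝ :=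
  F ((extChartAt 𝓘(ℝ, E) a).symm p.1) ((extChartAt 𝓘(ℝ, E) b).symm p.2)

/-- Near `(a, b)`, the functions `e n`, `n ≥ n₀`, are differentiable with differentials that are
Lipschitz in the chart, uniformly in `n` (as they are when the second derivatives of the `e n` are
bounded uniformly in `n`). -/
def UniformlyC11At (E : Type*) [NormedAddCommGroup E] [InnerProductSpace ℝ E]
    {G : Type*} [TopologicalSpace G] [ChartedSpace E G]
    (n₀ : ℕ) (e : ℕ → G → G → ℝ) (a b : G) : Prop :=
  ∃ M : ℝ≥0, ∃ S ∈ 𝓝 ((extChartAt 𝓘(ℝ, E) a a, extChartAt 𝓘(ℝ, E) b b) : E × E), ∀ n ≥ n₀,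
    DifferentiableOn ℝ (localRep (e n) a b) S ∧
      LipschitzOnWith M (fderiv ℝ (localRep (e n) a b)) S

/-- The remainders `eₙ` in `Fₙ = F + ρⁿ eₙ`. -/
def remainder (F : G → G → ℝ) (Fn : ℕ → G → G → ℝ) (ρ : ℝ) (n : ℕ) (x y : G) : ℝ :=
  (Fn n x y - F x y) / ρ ^ n

end

end LieGalerkin

/-! Both discrete Lagrangians are minimal values, so (a) follows by testing each minimization on a
competitor from the other. The Galerkin minimizer is itself a `C²` curve on the group, so `L_d^E` is
at most its action, which exceeds `L_{d,n}` by at most the quadrature error. Conversely, `L_{d,n}`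
is at most the discrete action of the approximating curve, which quadrature and the Lipschitz bounds
compare with `L_d^E`. The two minimizers need not be close to each other.

For (b), write `ρ = max K Kq`. Part (a) says that the remainders `eₙ` are uniformly bounded; since
their differentials are uniformly Lipschitz, those differentials are bounded at the base points too
(`norm_fderiv_le_of_bounded_of_lipschitz`). In charts the discrete Euler-Lagrange equation becomes
`A v + ρⁿ Bₙ v = 0`, where regularity makes the derivative of `A` invertible, and a quantitative
inverse function argument (`exists_unique_zero_of_perturbation`) moves the zero of `A` by `O(ρⁿ)`.

It remains to see that `q` gives a zero of `A` (`discreteEulerLagrange_of_le_action`). Vary `q` on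
`[0, 2h]` with fixed ends, moving `q h` in a given direction. The action minus the two exact
Lagrangians is nonnegative and vanishes at `q`, so its derivative is zero; Hamilton's principle
removes the contribution of the action. -/

namespace LieGalerkin

/-! ### Perturbation estimates in normed spaces -/

/-- A bounded function on a ball whose differential is Lipschitz has bounded differential at the
centre. -/
theorem norm_fderiv_le_of_bounded_of_lipschitz {X : Type*} [NormedAddCommGroup X] [NormedSpace ℝ X]
    {f : X → ℝ} {x : X} {r C : ℝ} {M : ℝ≥0} (hr : 0 < r)
    (hf : DifferentiableOn ℝ f (Metric.ball x r))
    (hM : LipschitzOnWith M (fderiv ℝ f) (Metric.ball x r))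
    (hC : ∀ y ∈ Metric.ball x r, |f y| ≤ C) :
    ‖fderiv ℝ f x‖ ≤ (2 * C + M * r * r) / (r / 2) := by
  have hx : x ∈ Metric.ball x r := Metric.mem_ball_self hr
  refine ContinuousLinearMap.opNorm_bound_of_ball_bound (half_pos hr) _ _ fun z hz => ?_
  have hz' : ‖z‖ ≤ r / 2 := by simpa using hz
  have hy : x + z ∈ Metric.ball x r := by simp; linarith
  -- On the ball the differential stays within `M * r` of its value at `x`, so the first-order
  -- Taylor error at `x + z` is at most `M * r * ‖z‖`. The two values of `f` contribute `2 * C`.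
  have key := Convex.norm_image_sub_le_of_norm_hasFDerivWithin_le' (𝕜 := ℝ) (f := f)
    (f' := fderiv ℝ f) (φ := fderiv ℝ f x) (C := M * r) (s := Metric.ball x r) (x := x) (y := x + z)
    (fun y hy => ((hf y hy).differentiableAt
      (Metric.isOpen_ball.mem_nhds hy)).hasFDerivAt.hasFDerivWithinAt)
    (fun y hy => by
      refine (hM.norm_sub_le hy hx).trans ?_
      gcongr
      rw [← dist_eq_norm]; exact (Metric.mem_ball.1 hy).le)
    (convex_ball x r) hx hy
  rw [add_sub_cancel_left] at key
  have h1 : (M : ℝ) * r * ‖z‖ ≤ M * r * r := by gcongr; linarith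
  have h2 := hC _ hx
  have h3 := hC _ hy
  rw [Real.norm_eq_abs] at key ⊢
  rw [abs_le] at *
  constructor <;> linarith [key.1, key.2, h2.1, h2.2, h3.1, h3.2]

/-- Zeros of `A + ρⁿ Bₙ` near a nondegenerate zero of `A`. -/
theorem exists_unique_zero_of_perturbation {X Y : Type*} [NormedAddCommGroup X] [NormedSpace ℝ X]
    [CompleteSpace X] [NormedAddCommGroup Y] [NormedSpace ℝ Y]
    {A : X → Y} {A' : X ≃L[ℝ] Y} {x : X} (hA : HasStrictFDerivAt A (A' : X →L[ℝ] Y) x)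
    (hAx : A x = 0) {B : ℕ → X → Y} {n₀ : ℕ} {S : Set X} (hS : S ∈ 𝓝 x) {M : ℝ≥0}
    (hB : ∀ n ≥ n₀, LipschitzOnWith M (B n) S) {D : ℝ} (hD : ∀ n ≥ n₀, ‖B n x‖ ≤ D)
    {ρ : ℝ} (hρ : 0 < ρ) (hρ₁ : ρ < 1) :
    ∃ ε > 0, Metric.closedBall x ε ⊆ S ∧ ∃ C : ℝ, ∃ n₁ ≥ n₀, ∀ n ≥ n₁,
      ∃ y ∈ Metric.closedBall x ε, A y + ρ ^ n • B n y = 0 ∧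
        (∀ z ∈ Metric.closedBall x ε, A z + ρ ^ n • B n z = 0 → z = y) ∧ ‖y - x‖ ≤ C * ρ ^ n := by
  -- The summand `1` keeps `N` positive even when the spaces are trivial.
  obtain ⟨N, hN, hNsymm⟩ : ∃ N : ℝ≥0, 0 < N ∧ ∀ y, ‖A'.symm y‖ ≤ N * ‖y‖ :=
    ⟨‖(A'.symm : Y →L[ℝ] X)‖₊ + 1, by positivity, fun y =>
      ((A'.symm : Y →L[ℝ] X).le_opNorm y).trans (by
        push_cast; gcongr; simp)⟩
  have hN' : (0 : ℝ) < N := hN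
  -- The nonlinearity of `A` and the perturbation get `1/(4N)` each. Together they stay at `1/(2N)`,
  -- half of the threshold `1/N` below which invertibility of `A'` survives.
  obtain ⟨S', hS', hAS⟩ := hA.approximates_deriv_on_nhds (c := (4 * N)⁻¹) (Or.inr (by positivity))
  obtain ⟨ε, hε, hεS⟩ := Metric.nhds_basis_closedBall.mem_iff.1 (inter_mem hS hS')
  have htend : Tendsto (fun n : ℕ => ρ ^ n) atTop (𝓝 0) :=
    tendsto_pow_atTop_nhds_zero_of_lt_one hρ.le hρ₁
  have e1 : ∀ᶠ n in atTop, ρ ^ n * M ≤ (4 * N : ℝ)⁻¹ := by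
    have := htend.mul_const (M : ℝ)
    rw [zero_mul] at this
    exact this.eventually_le_const (by positivity)
  have e2 : ∀ᶠ n in atTop, ρ ^ n * D ≤ (2 * N : ℝ)⁻¹ * ε := by
    have := htend.mul_const D
    rw [zero_mul] at this
    exact this.eventually_le_const (by positivity)
  obtain ⟨n₁, hn₁⟩ := eventually_atTop.1 (e1.and (e2.and (eventually_ge_atTop n₀)))
  refine ⟨ε, hε, hεS.trans inter_subset_left, 2 * N * D, max n₁ n₀, le_max_right _ _,
    fun n hn => ?_⟩
  obtain ⟨h1, h2, h3⟩ := hn₁ n ((le_max_left _ _).trans hn)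
  set H : X → Y := fun y => A y + ρ ^ n • B n y with hH
  have hHapp : ApproximatesLinearOn H (A' : X →L[ℝ] Y) (Metric.closedBall x ε) (2 * N)⁻¹ := by
    intro u hu v hv
    have ha := hAS u (hεS hu).2 v (hεS hv).2
    have hb := (hB n h3).norm_sub_le (hεS hu).1 (hεS hv).1
    have : H u - H v - (A' : X →L[ℝ] Y) (u - v)
        = (A u - A v - (A' : X →L[ℝ] Y) (u - v)) + ρ ^ n • (B n u - B n v) := by
      simp only [hH, smul_sub]; abel
    rw [this]
    refine (norm_add_le _ _).trans ?_
    rw [norm_smul, Real.norm_of_nonneg (by positivity)]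
    have hb' : ρ ^ n * ‖B n u - B n v‖ ≤ (4 * N : ℝ)⁻¹ * ‖u - v‖ :=
      calc ρ ^ n * ‖B n u - B n v‖ ≤ ρ ^ n * (M * ‖u - v‖) := by gcongr
        _ = ρ ^ n * M * ‖u - v‖ := by ring
        _ ≤ _ := by gcongr
    push_cast at ha ⊢
    have : (2 * N : ℝ)⁻¹ = (4 * N : ℝ)⁻¹ + (4 * N : ℝ)⁻¹ := by field_simp; norm_num
    rw [this, add_mul]
    exact add_le_add ha hb'
  -- This expansion estimate serves twice: applied to two zeros it gives uniqueness, and applied to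
  -- a zero and `x` it gives the rate.
  have hanti : ∀ u ∈ Metric.closedBall x ε, ∀ v ∈ Metric.closedBall x ε,
      ‖u - v‖ ≤ 2 * N * ‖H u - H v‖ := by
    intro u hu v hv
    have ha := hHapp u hu v hv
    have hb := hNsymm (A' (u - v))
    rw [A'.symm_apply_apply] at hb
    have hc : ‖A' (u - v)‖ ≤ ‖H u - H v‖ + (2 * N : ℝ)⁻¹ * ‖u - v‖ := by
      have := norm_sub_norm_le (A' (u - v)) (H u - H v)
      rw [norm_sub_rev (A' (u - v))] at this
      have ha' : ‖H u - H v - A' (u - v)‖ ≤ (2 * N : ℝ)⁻¹ * ‖u - v‖ := by simpa using ha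
      linarith
    have hd : ‖u - v‖ ≤ N * ‖H u - H v‖ + ‖u - v‖ / 2 :=
      calc ‖u - v‖ ≤ N * (‖H u - H v‖ + (2 * N : ℝ)⁻¹ * ‖u - v‖) := hb.trans (by gcongr)
        _ = _ := by field_simp
    linarith
  have hHx : ‖H x‖ ≤ ρ ^ n * D := by
    simp only [hH, hAx, zero_add, norm_smul, Real.norm_of_nonneg (pow_nonneg hρ.le n)]
    gcongr
    exact hD n h3
  have hsurj := hHapp.surjOn_closedBall_of_nonlinearRightInverse
    ⟨A'.symm, N, hNsymm, A'.apply_symm_apply⟩ hε.le Subset.rfl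
  -- The image of the ball covers radius `(1/N - 1/(2N)) * ε = ε/(2N)` around `H x`, which is the
  -- smallness imposed on `ρ ^ n * D`.
  have h0 : (0 : Y) ∈ Metric.closedBall (H x) ((((N : ℝ≥0) : ℝ)⁻¹ - ((2 * N)⁻¹ : ℝ≥0)) * ε) := by
    rw [Metric.mem_closedBall, dist_zero_left]
    refine hHx.trans (h2.trans (le_of_eq ?_))
    push_cast
    field_simp
    norm_num
  obtain ⟨y, hy, hHy⟩ := hsurj h0
  refine ⟨y, hy, hHy, fun z hz hHz => ?_, ?_⟩
  · have := hanti z hz y hy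
    rw [show H z = 0 from hHz, hHy, sub_zero, norm_zero, mul_zero] at this
    exact sub_eq_zero.1 (norm_le_zero_iff.1 this)
  · have := hanti y hy x (Metric.mem_closedBall_self hε.le)
    rw [hHy, zero_sub, norm_neg] at this
    calc ‖y - x‖ ≤ 2 * N * ‖H x‖ := this
      _ ≤ 2 * N * (ρ ^ n * D) := by gcongr
      _ = _ := by ring

/-! ### Actions of curves: restriction, shift, comparison -/

section Action

variable {E : Type*} [NormedAddCommGroup E] [InnerProductSpace ℝ E]
  {G : Type*} [TopologicalSpace G] [ChartedSpace E G]

theorem lift_congr {T t : ℝ} {g k : ℝ → G} (hgk : EqOn g k (Icc 0 T)) (ht : t ∈ Icc 0 T) :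
    lift E T g t = lift E T k t :=
  tangentMapWithin_congr (I := 𝓘(ℝ, ℝ)) (I' := 𝓘(ℝ, E)) hgk ⟨t, (1 : ℝ)⟩ ht

theorem action_congr {L : TangentBundle 𝓘(ℝ, E) G → ℝ} {T : ℝ} (hT : 0 ≤ T) {g k : ℝ → G}
    (hgk : EqOn g k (Icc 0 T)) : action L T g = action L T k := by
  refine intervalIntegral.integral_congr fun t ht => ?_
  rw [uIcc_of_le hT] at ht
  simp only [lift_congr hgk ht]

theorem uniqueMDiffOn_Icc_zero {T : ℝ} (hT : 0 < T) : UniqueMDiffOn 𝓘(ℝ, ℝ) (Icc 0 T) :=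
  (uniqueDiffOn_Icc hT).uniqueMDiffOn

theorem continuousOn_lift [IsManifold 𝓘(ℝ, E) 1 G] {T : ℝ} (hT : 0 < T) {g : ℝ → G}
    (hg : IsC2Curve E T g) : ContinuousOn (lift E T g) (Icc 0 T) := by
  have h1 := ContMDiffOn.continuousOn_tangentMapWithin hg (by norm_num) (uniqueMDiffOn_Icc_zero hT)
  have h2 : Continuous (fun t : ℝ => (⟨t, (1 : ℝ)⟩ : TangentBundle 𝓘(ℝ, ℝ) ℝ)) := by
    have := (tangentBundleModelSpaceHomeomorph 𝓘(ℝ, ℝ)).symm.continuous.comp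
      (Continuous.prodMk (X := ℝ) continuous_id (continuous_const (y := (1 : ℝ))))
    exact this
  exact h1.comp h2.continuousOn fun t ht => ht

theorem intervalIntegrable_lagrangian [IsManifold 𝓘(ℝ, E) 1 G]
    {L : TangentBundle 𝓘(ℝ, E) G → ℝ} (hL : Continuous L) {T : ℝ} (hT : 0 < T) {g : ℝ → G}
    (hg : IsC2Curve E T g) {a b : ℝ} (ha : a ∈ Icc 0 T) (hb : b ∈ Icc 0 T) :
    IntervalIntegrable (fun t => L (lift E T g t)) MeasureTheory.volume a b :=
  ((hL.comp_continuousOn (continuousOn_lift hT hg)).mono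
    (ordConnected_Icc.uIcc_subset ha hb)).intervalIntegrable

/-- At interior times the velocity does not depend on the interval, so lifts taken over different
intervals can be compared there. -/
theorem lift_eq_tangentMap {T t : ℝ} {g : ℝ → G} (ht : t ∈ Ioo 0 T) :
    lift E T g t = tangentMap 𝓘(ℝ, ℝ) 𝓘(ℝ, E) g ⟨t, (1 : ℝ)⟩ := by
  unfold lift tangentMap
  rw [mfderivWithin_of_mem_nhds (Icc_mem_nhds ht.1 ht.2)]

theorem tangentMap_shift {g : ℝ → G} {a t : ℝ} (hg : MDifferentiableAt 𝓘(ℝ, ℝ) 𝓘(ℝ, E) g (a + t)) :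
    tangentMap 𝓘(ℝ, ℝ) 𝓘(ℝ, E) (fun s => g (a + s)) ⟨t, (1 : ℝ)⟩ =
      tangentMap 𝓘(ℝ, ℝ) 𝓘(ℝ, E) g ⟨a + t, (1 : ℝ)⟩ := by
  have hd : HasDerivAt (fun s => a + s) 1 t := by simpa using (hasDerivAt_id t).const_add a
  have h := tangentMap_comp_at (I := 𝓘(ℝ, ℝ)) (I' := 𝓘(ℝ, ℝ)) (I'' := 𝓘(ℝ, E)) (g := g)
    (f := fun s : ℝ => a + s) ⟨t, (1 : ℝ)⟩ hg hd.differentiableAt.mdifferentiableAt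
  refine h.trans ?_
  congr 1
  simp only [tangentMap, mfderiv_eq_fderiv]
  congr 1
  exact (fderiv_apply_one_eq_deriv.trans hd.deriv : fderiv ℝ (fun s => a + s) t 1 = 1)

theorem IsC2Curve.restrict {T S : ℝ} (hST : S ≤ T) {g : ℝ → G} (hg : IsC2Curve E T g) :
    IsC2Curve E S g :=
  ContMDiffOn.mono hg (Icc_subset_Icc_right hST)

theorem IsC2Curve.shift {T a : ℝ} (ha : 0 ≤ a) {g : ℝ → G} (hg : IsC2Curve E T g) :
    IsC2Curve E (T - a) (fun t => g (a + t)) := by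
  refine ContMDiffOn.comp (g := g) (f := fun t : ℝ => a + t) (t := Icc 0 T) hg
    (contDiff_const.add contDiff_id).contMDiff.contMDiffOn fun t ht => ?_
  exact ⟨by linarith [ht.1], by linarith [ht.2]⟩

/-- The action over `[0,T]` is the sum of the actions over `[0,a]` and, after a shift, `[a,T]`. -/
theorem action_eq_add_shift [IsManifold 𝓘(ℝ, E) 1 G] {L : TangentBundle 𝓘(ℝ, E) G → ℝ}
    (hL : Continuous L) {T a : ℝ} (ha : 0 < a) (haT : a < T) {g : ℝ → G} (hg : IsC2Curve E T g) :
    action L T g = action L a g + action L (T - a) (fun t => g (a + t)) := by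
  have hT : 0 < T := ha.trans haT
  have hi := fun {x y : ℝ} => intervalIntegrable_lagrangian (a := x) (b := y) hL hT hg
  have hmem : a ∈ Icc 0 T := ⟨ha.le, haT.le⟩
  unfold action
  rw [← intervalIntegral.integral_add_adjacent_intervals
    (hi (left_mem_Icc.2 hT.le) hmem) (hi hmem (right_mem_Icc.2 hT.le))]
  congr 1
  -- Endpoints, where the velocities are one-sided and depend on the interval, form a null set and
  -- are discarded.
  · rw [intervalIntegral.integral_of_le ha.le, intervalIntegral.integral_of_le ha.le,
      MeasureTheory.integral_Ioc_eq_integral_Ioo, MeasureTheory.integral_Ioc_eq_integral_Ioo]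
    refine MeasureTheory.setIntegral_congr_fun measurableSet_Ioo fun t ht => ?_
    simp only [lift_eq_tangentMap ht, lift_eq_tangentMap (⟨ht.1, ht.2.trans haT⟩ : t ∈ Ioo 0 T)]
  · have := intervalIntegral.integral_comp_add_left (a := 0) (b := T - a)
      (fun t => L (lift E T g t)) a
    rw [add_zero, add_sub_cancel] at this
    have hTa : 0 ≤ T - a := by linarith
    rw [← this, intervalIntegral.integral_of_le hTa, intervalIntegral.integral_of_le hTa,
      MeasureTheory.integral_Ioc_eq_integral_Ioo, MeasureTheory.integral_Ioc_eq_integral_Ioo]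
    refine MeasureTheory.setIntegral_congr_fun measurableSet_Ioo fun t ht => ?_
    have hm : a + t ∈ Ioo 0 T := ⟨by linarith [ht.1], by linarith [ht.2]⟩
    have hd : MDifferentiableAt 𝓘(ℝ, ℝ) 𝓘(ℝ, E) g (a + t) :=
      (ContMDiffOn.contMDiffAt hg (Icc_mem_nhds hm.1 hm.2)).mdifferentiableAt (by norm_num)
    simp only [lift_eq_tangentMap ht, lift_eq_tangentMap hm, tangentMap_shift hd]

/-- Two curves on which the Lagrangian differs by at most `B` have actions that differ by at most
`B T`. -/
theorem action_sub_le [IsManifold 𝓘(ℝ, E) 1 G] {L : TangentBundle 𝓘(ℝ, E) G → ℝ}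
    (hL : Continuous L) {T : ℝ} (hT : 0 < T)
    {g k : ℝ → G} (hg : IsC2Curve E T g) (hk : IsC2Curve E T k) {B : ℝ}
    (hB : ∀ t ∈ Icc 0 T, |L (lift E T g t) - L (lift E T k t)| ≤ B) :
    |action L T g - action L T k| ≤ B * T := by
  have hl : (0 : ℝ) ∈ Icc 0 T := left_mem_Icc.2 hT.le
  have hr : T ∈ Icc 0 T := right_mem_Icc.2 hT.le
  unfold action
  rw [← intervalIntegral.integral_sub (intervalIntegrable_lagrangian hL hT hg hl hr)
    (intervalIntegrable_lagrangian hL hT hk hl hr)]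
  have := intervalIntegral.norm_integral_le_of_norm_le_const (a := 0) (b := T) (C := B)
    (f := fun t => L (lift E T g t) - L (lift E T k t)) fun t ht => by
      rw [uIoc_of_le hT.le] at ht
      exact hB t ⟨ht.1.le, ht.2⟩
  rwa [sub_zero, abs_of_pos hT] at this

end Action

/-! ### Regularity of Galerkin curves -/

section Galerkin

variable {E : Type*} [NormedAddCommGroup E] [InnerProductSpace ℝ E]
  {G : Type*} [TopologicalSpace G] [ChartedSpace E G] [Group G] [LieGroup 𝓘(ℝ, E) ∞ G]

theorem isC2Curve_chartCurve {Φ : E → G} {U : Set E}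
    (hΦ : IsLocalDiffeomorphOn 𝓘(ℝ, E) 𝓘(ℝ, E) ∞ Φ U) {h : ℝ} (g₀ : G) {ζ : ℝ → E}
    (hζ : ContDiffOn ℝ 2 ζ (Icc 0 h)) (hU : MapsTo ζ (Icc 0 h) U) :
    IsC2Curve E h (chartCurve Φ g₀ ζ) := by
  have h1 : ContMDiffOn 𝓘(ℝ, ℝ) 𝓘(ℝ, E) 2 (Φ ∘ ζ) (Icc 0 h) :=
    (hΦ.contMDiffOn.of_le (by exact ENat.LEInfty.out)).comp hζ.contMDiffOn hU
  have h2 : ContMDiff 𝓘(ℝ, E) 𝓘(ℝ, E) 2 (fun x : G => g₀ * x) :=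
    (contMDiff_mul_left (I := 𝓘(ℝ, E)) (n := ∞) (a := g₀)).of_le (by exact ENat.LEInfty.out)
  exact h2.comp_contMDiffOn h1

theorem contDiffOn_of_mem_algSpace {n : ℕ} {φ : Fin n → ℝ → ℝ} {s : Set ℝ}
    (hφ : ∀ i, ContDiffOn ℝ 2 (φ i) s) {η : ℝ → E} (hη : η ∈ algSpace E φ) :
    ContDiffOn ℝ 2 η s := by
  obtain ⟨a, rfl⟩ := hη
  exact ContDiffOn.sum fun i _ => (hφ i).smul contDiffOn_const

end Galerkin

/-! ### Discrete Euler-Lagrange equations in charts -/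

section Charts

variable {E : Type*} [NormedAddCommGroup E] [InnerProductSpace ℝ E]
  {G : Type*} [TopologicalSpace G] [ChartedSpace E G]

/-- The manifold derivative at `a` is by definition taken in the preferred chart at `a`, so no
transition map appears; only continuity needs an argument. -/
theorem hasMFDerivAt_of_comp_extChartAt_symm {X : Type*} [NormedAddCommGroup X] [NormedSpace ℝ X]
    {f : G → X} {a : G} {f' : E →L[ℝ] X}
    (hf : HasFDerivAt (fun v => f ((extChartAt 𝓘(ℝ, E) a).symm v)) f' (extChartAt 𝓘(ℝ, E) a a)) :
    HasMFDerivAt 𝓘(ℝ, E) 𝓘(ℝ, X) f a f' := by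
  refine ⟨?_, ?_⟩
  · have h1 : ContinuousAt (fun z => f ((extChartAt 𝓘(ℝ, E) a).symm (extChartAt 𝓘(ℝ, E) a z))) a :=
      ContinuousAt.comp (f := extChartAt 𝓘(ℝ, E) a)
        (g := fun v => f ((extChartAt 𝓘(ℝ, E) a).symm v)) hf.continuousAt
        (continuousAt_extChartAt a)
    refine h1.congr ?_
    filter_upwards [extChartAt_source_mem_nhds (I := 𝓘(ℝ, E)) a] with z hz
    rw [(extChartAt 𝓘(ℝ, E) a).left_inv hz]
  · exact hf.hasFDerivWithinAt

/-- The differentiated point must be the centre of its chart, while the other may vary in a fixed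
chart. This is what the discrete Euler-Lagrange equation needs: its unknown enters only as the
second argument of `D₁`, so the equation can be written in fixed coordinates. -/
theorem D₁_eq {F : G → G → ℝ} {a b y : G} (hy : y ∈ (extChartAt 𝓘(ℝ, E) b).source)
    (hF : DifferentiableAt ℝ (localRep F a b)
      ((extChartAt 𝓘(ℝ, E) a a, extChartAt 𝓘(ℝ, E) b y) : E × E)) :
    D₁ E F a y = (fderiv ℝ (localRep F a b)
      ((extChartAt 𝓘(ℝ, E) a a, extChartAt 𝓘(ℝ, E) b y) : E × E)).comp
        (ContinuousLinearMap.inl ℝ E E) := by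
  refine HasMFDerivAt.mfderiv (hasMFDerivAt_of_comp_extChartAt_symm ?_)
  have := hF.hasFDerivAt.comp (extChartAt 𝓘(ℝ, E) a a)
    (hasFDerivAt_prodMk_left (𝕜 := ℝ) (extChartAt 𝓘(ℝ, E) a a) (extChartAt 𝓘(ℝ, E) b y))
  refine this.congr_of_eventuallyEq (Eventually.of_forall fun v => ?_)
  simp only [Function.comp, localRep, (extChartAt 𝓘(ℝ, E) b).left_inv hy]

theorem D₂_eq {F : G → G → ℝ} {a b x : G} (hx : x ∈ (extChartAt 𝓘(ℝ, E) a).source)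
    (hF : DifferentiableAt ℝ (localRep F a b)
      ((extChartAt 𝓘(ℝ, E) a x, extChartAt 𝓘(ℝ, E) b b) : E × E)) :
    D₂ E F x b = (fderiv ℝ (localRep F a b)
      ((extChartAt 𝓘(ℝ, E) a x, extChartAt 𝓘(ℝ, E) b b) : E × E)).comp
        (ContinuousLinearMap.inr ℝ E E) := by
  refine HasMFDerivAt.mfderiv (hasMFDerivAt_of_comp_extChartAt_symm ?_)
  have := hF.hasFDerivAt.comp (extChartAt 𝓘(ℝ, E) b b)
    (hasFDerivAt_prodMk_right (𝕜 := ℝ) (extChartAt 𝓘(ℝ, E) a x) (extChartAt 𝓘(ℝ, E) b b))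
  refine this.congr_of_eventuallyEq (Eventually.of_forall fun v => ?_)
  simp only [Function.comp, localRep, (extChartAt 𝓘(ℝ, E) a).left_inv hx]

theorem tendsto_extChartAt_symm_prodMap (a b : G) :
    Tendsto (fun p : E × E => ((extChartAt 𝓘(ℝ, E) a).symm p.1, (extChartAt 𝓘(ℝ, E) b).symm p.2))
      (𝓝 (extChartAt 𝓘(ℝ, E) a a, extChartAt 𝓘(ℝ, E) b b)) (𝓝 (a, b)) := by
  have ha := continuousAt_extChartAt_symm (I := 𝓘(ℝ, E)) a
  have hb := continuousAt_extChartAt_symm (I := 𝓘(ℝ, E)) b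
  rw [ContinuousAt, extChartAt_to_inv] at ha hb
  rw [nhds_prod_eq, nhds_prod_eq]
  exact ha.prodMap hb

theorem contDiffAt_localRep {F : G → G → ℝ} {a b : G} {k : ℕ∞ω}
    (hF : ContMDiffAt (𝓘(ℝ, E).prod 𝓘(ℝ, E)) 𝓘(ℝ, ℝ) k (fun p : G × G => F p.1 p.2) (a, b)) :
    ContDiffAt ℝ k (localRep F a b) (extChartAt 𝓘(ℝ, E) a a, extChartAt 𝓘(ℝ, E) b b) := by
  have := (contMDiffAt_iff.1 hF).2
  rw [extChartAt_prod, ModelWithCorners.range_eq_univ, contDiffWithinAt_univ] at this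
  exact this

/-- A bounded family of functions with uniformly Lipschitz differentials has uniformly bounded
differentials at the base point. -/
theorem UniformlyC11At.exists_ball {n₀ : ℕ} {e : ℕ → G → G → ℝ} {a b : G}
    (he : UniformlyC11At E n₀ e a b) {C : ℝ}
    (hC : ∀ᶠ p : G × G in 𝓝 (a, b), ∀ n ≥ n₀, |e n p.1 p.2| ≤ C) :
    ∃ M : ℝ≥0, ∃ D r : ℝ, 0 < r ∧ ∀ n ≥ n₀,
      DifferentiableOn ℝ (localRep (e n) a b)
        (Metric.ball (extChartAt 𝓘(ℝ, E) a a, extChartAt 𝓘(ℝ, E) b b) r) ∧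
      LipschitzOnWith M (fderiv ℝ (localRep (e n) a b))
        (Metric.ball (extChartAt 𝓘(ℝ, E) a a, extChartAt 𝓘(ℝ, E) b b) r) ∧
      ‖fderiv ℝ (localRep (e n) a b)
        (extChartAt 𝓘(ℝ, E) a a, extChartAt 𝓘(ℝ, E) b b)‖ ≤ D := by
  obtain ⟨M, S, hS, h⟩ := he
  have hC' := (tendsto_extChartAt_symm_prodMap (E := E) a b).eventually hC
  obtain ⟨r, hr, hrS⟩ := Metric.mem_nhds_iff.1 (inter_mem hS hC')
  have hrS₁ := hrS.trans inter_subset_left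
  refine ⟨M, _, r, hr, fun n hn => ⟨(h n hn).1.mono hrS₁, (h n hn).2.mono hrS₁,
    norm_fderiv_le_of_bounded_of_lipschitz (C := C) hr ((h n hn).1.mono hrS₁)
      ((h n hn).2.mono hrS₁) fun p hp => (hrS hp).2 n hn⟩⟩

theorem norm_comp_inl_le (l : E × E →L[ℝ] ℝ) :
    ‖l.comp (ContinuousLinearMap.inl ℝ E E)‖ ≤ ‖l‖ :=
  (l.opNorm_comp_le _).trans
    (mul_le_of_le_one_right (norm_nonneg _) (ContinuousLinearMap.norm_inl_le_one ℝ E E))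

theorem norm_comp_inr_le (l : E × E →L[ℝ] ℝ) :
    ‖l.comp (ContinuousLinearMap.inr ℝ E E)‖ ≤ ‖l‖ :=
  (l.opNorm_comp_le _).trans
    (mul_le_of_le_one_right (norm_nonneg _) (ContinuousLinearMap.norm_inr_le_one ℝ E E))

/-- The differential of a regular discrete Lagrangian, as a map of the second point, has an
invertible strict derivative. -/
theorem IsRegularAt.exists_hasStrictFDerivAt [FiniteDimensional ℝ E] {F : G → G → ℝ} {a b : G}
    (hreg : IsRegularAt E F a b)
    (hF : ContDiffAt ℝ 2 (localRep F a b) (extChartAt 𝓘(ℝ, E) a a, extChartAt 𝓘(ℝ, E) b b)) :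
    ∃ A' : E ≃L[ℝ] (E →L[ℝ] ℝ), HasStrictFDerivAt
      (fun v => (fderiv ℝ (localRep F a b) (extChartAt 𝓘(ℝ, E) a a, v)).comp
        (ContinuousLinearMap.inl ℝ E E)) (A' : E →L[ℝ] (E →L[ℝ] ℝ)) (extChartAt 𝓘(ℝ, E) b b) := by
  set x := extChartAt 𝓘(ℝ, E) a a
  set y := extChartAt 𝓘(ℝ, E) b b
  set Ψ : E → E →L[ℝ] ℝ := fun v => (fderiv ℝ (localRep F a b) (x, v)).comp
    (ContinuousLinearMap.inl ℝ E E) with hΨ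
  have h1 : ContDiffAt ℝ 1 (fderiv ℝ (localRep F a b)) (x, y) :=
    hF.fderiv_right (by norm_num)
  have h2 : ContDiffAt ℝ 1 (fun v : E => fderiv ℝ (localRep F a b) (x, v)) y :=
    ContDiffAt.comp (g := fderiv ℝ (localRep F a b)) (f := fun v : E => (x, v)) y h1
      (contDiffAt_const.prodMk contDiffAt_id)
  have h3 : ContDiffAt ℝ 1 Ψ y := h2.clm_comp contDiffAt_const
  have h4 : HasStrictFDerivAt Ψ (fderiv ℝ Ψ y) y := h3.hasStrictFDerivAt (by norm_num)
  have hdiff : ∀ᶠ v in 𝓝 y, DifferentiableAt ℝ (localRep F a b) (x, v) := by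
    have : ∀ᶠ p in 𝓝 (x, y), DifferentiableAt ℝ (localRep F a b) p :=
      (hF.eventually (by norm_num)).mono fun p hp => hp.differentiableAt (by norm_num)
    exact (Continuous.prodMk_right x).continuousAt.eventually this
  have h5 : mfderiv 𝓘(ℝ, E) 𝓘(ℝ, E →L[ℝ] ℝ) (fun z => D₁ E F a z) b = fderiv ℝ Ψ y := by
    refine HasMFDerivAt.mfderiv (hasMFDerivAt_of_comp_extChartAt_symm ?_)
    refine h4.hasFDerivAt.congr_of_eventuallyEq ?_
    filter_upwards [hdiff, extChartAt_target_mem_nhds (I := 𝓘(ℝ, E)) b] with v hv hvt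
    have hr := (extChartAt 𝓘(ℝ, E) b).right_inv hvt
    have := D₁_eq (F := F) (a := a) ((extChartAt 𝓘(ℝ, E) b).map_target hvt) (by rwa [hr])
    rw [this, hr]
  have hinj : Function.Injective (fderiv ℝ Ψ y) := h5 ▸ hreg
  -- Equal finite dimensions turn the injectivity in `IsRegularAt` into invertibility.
  have hdim : Module.finrank ℝ E = Module.finrank ℝ (E →L[ℝ] ℝ) := by
    rw [← (LinearMap.toContinuousLinearMap (𝕜 := ℝ) (E := E) (F' := ℝ)).finrank_eq]
    exact (Subspace.dual_finrank_eq (K := ℝ) (V := E)).symm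
  refine ⟨(LinearMap.linearEquivOfInjective (fderiv ℝ Ψ y : E →ₗ[ℝ] E →L[ℝ] ℝ) hinj
    hdim).toContinuousLinearEquiv, ?_⟩
  convert h4 using 1
  ext1 w
  rfl

/-- Perturbing a regular discrete Lagrangian by `ρⁿ eₙ` moves the solution of the discrete
Euler-Lagrange equations by `O(ρⁿ)`. -/
theorem exists_unique_discreteEulerLagrange [FiniteDimensional ℝ E] {F : G → G → ℝ}
    {Fn : ℕ → G → G → ℝ} {n₀ : ℕ} {ρ C : ℝ} (hρ : 0 < ρ) (hρ₁ : ρ < 1) {a b d : G}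
    (hab : ContDiffAt ℝ 2 (localRep F a b) (extChartAt 𝓘(ℝ, E) a a, extChartAt 𝓘(ℝ, E) b b))
    (hbd : ContDiffAt ℝ 2 (localRep F b d) (extChartAt 𝓘(ℝ, E) b b, extChartAt 𝓘(ℝ, E) d d))
    (hDEL : DiscreteEulerLagrange E F a b d) (hreg : IsRegularAt E F b d)
    (heab : UniformlyC11At E n₀ (remainder F Fn ρ) a b)
    (hebd : UniformlyC11At E n₀ (remainder F Fn ρ) b d)
    (hCab : ∀ᶠ p : G × G in 𝓝 (a, b), ∀ n ≥ n₀, |remainder F Fn ρ n p.1 p.2| ≤ C)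
    (hCbd : ∀ᶠ p : G × G in 𝓝 (b, d), ∀ n ≥ n₀, |remainder F Fn ρ n p.1 p.2| ≤ C) :
    ∃ N ∈ 𝓝 d, ∃ C : ℝ, ∃ n₁ : ℕ, ∀ n ≥ n₁, ∃ y ∈ N,
      DiscreteEulerLagrange E (Fn n) a b y ∧
      (∀ z ∈ N, DiscreteEulerLagrange E (Fn n) a b z → z = y) ∧
      ‖extChartAt 𝓘(ℝ, E) d y - extChartAt 𝓘(ℝ, E) d d‖ ≤ C * ρ ^ n := by
  obtain ⟨M₁, D₁', r₁, hr₁, he₁⟩ := heab.exists_ball hCab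
  obtain ⟨M₂, D₂', r₂, hr₂, he₂⟩ := hebd.exists_ball hCbd
  obtain ⟨A', hA'⟩ := hreg.exists_hasStrictFDerivAt hbd
  set e := remainder F Fn ρ with he
  set cd := extChartAt 𝓘(ℝ, E) d
  set α := extChartAt 𝓘(ℝ, E) a a
  set β := extChartAt 𝓘(ℝ, E) b b
  -- The `D₂` terms at `(a, b)` do not involve the unknown, so `A₀` and `B₀ n` are constants added
  -- to the `D₁` terms `A₁` and `B₁ n`.
  set A₀ : E →L[ℝ] ℝ := (fderiv ℝ (localRep F a b) (α, β)).comp (ContinuousLinearMap.inr ℝ E E)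
    with hA₀
  set A₁ : E → E →L[ℝ] ℝ := fun v => (fderiv ℝ (localRep F b d) (β, v)).comp
    (ContinuousLinearMap.inl ℝ E E) with hA₁
  set B₀ : ℕ → E →L[ℝ] ℝ := fun n => (fderiv ℝ (localRep (e n) a b) (α, β)).comp
    (ContinuousLinearMap.inr ℝ E E) with hB₀
  set B₁ : ℕ → E → E →L[ℝ] ℝ := fun n v => (fderiv ℝ (localRep (e n) b d) (β, v)).comp
    (ContinuousLinearMap.inl ℝ E E) with hB₁
  have hFn : ∀ n (x y : G), localRep (Fn n) x y =
      fun p : E × E => localRep F x y p + ρ ^ n * localRep (e n) x y p := by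
    intro n x y
    funext p
    simp only [localRep, he, remainder]
    field_simp
    ring
  have hfd : ∀ n (x y : G) (p : E × E), DifferentiableAt ℝ (localRep F x y) p →
      DifferentiableAt ℝ (localRep (e n) x y) p →
      HasFDerivAt (localRep (Fn n) x y)
        (fderiv ℝ (localRep F x y) p + ρ ^ n • fderiv ℝ (localRep (e n) x y) p) p := by
    intro n x y p h1 h2
    rw [hFn]
    exact h1.hasFDerivAt.add (h2.hasFDerivAt.const_mul _)
  have hFab : DifferentiableAt ℝ (localRep F a b) (α, β) := hab.differentiableAt (by norm_num)
  have hFbd : ∀ᶠ v in 𝓝 (cd d), DifferentiableAt ℝ (localRep F b d) (β, v) := by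
    have : ∀ᶠ p in 𝓝 (β, cd d), DifferentiableAt ℝ (localRep F b d) p :=
      (hbd.eventually (by norm_num)).mono fun p hp => hp.differentiableAt (by norm_num)
    exact (Continuous.prodMk_right β).continuousAt.eventually this
  have hmem : ∀ v ∈ Metric.ball (cd d) r₂, (β, v) ∈ Metric.ball (β, cd d) r₂ := by
    intro v hv
    rw [Metric.mem_ball, Prod.dist_eq, max_lt_iff]
    exact ⟨by simpa using hr₂, hv⟩
  have hA : HasStrictFDerivAt (fun v => A₀ + A₁ v) (A' : E →L[ℝ] E →L[ℝ] ℝ) (cd d) :=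
    hA'.const_add A₀
  have hA0 : A₀ + A₁ (cd d) = 0 := by
    have h1 := D₂_eq (E := E) (F := F) (b := b) (mem_extChartAt_source (I := 𝓘(ℝ, E)) a) hFab
    have h2 := D₁_eq (E := E) (F := F) (a := b) (mem_extChartAt_source (I := 𝓘(ℝ, E)) d)
      hFbd.self_of_nhds
    unfold DiscreteEulerLagrange at hDEL
    rwa [h1, h2] at hDEL
  -- Points of `S` come from points of `G` near `d`, and both `F` and the remainders are
  -- differentiable there, so the chart formula for `D₁` applies.
  set S : Set E := Metric.ball (cd d) r₂ ∩
    (cd.target ∩ {v | DifferentiableAt ℝ (localRep F b d) (β, v)}) with hS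
  have hSn : S ∈ 𝓝 (cd d) :=
    inter_mem (Metric.ball_mem_nhds _ hr₂)
      (inter_mem (extChartAt_target_mem_nhds (I := 𝓘(ℝ, E)) d) hFbd)
  have hB : ∀ n ≥ n₀, LipschitzOnWith M₂ (fun v => B₀ n + B₁ n v) S := by
    intro n hn
    refine LipschitzOnWith.of_dist_le_mul fun u hu v hv => ?_
    rw [dist_add_left, dist_eq_norm]
    simp only [hB₁, ← ContinuousLinearMap.sub_comp]
    refine (norm_comp_inl_le _).trans ?_
    have := (he₂ n hn).2.1.dist_le_mul _ (hmem u hu.1) _ (hmem v hv.1)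
    rw [dist_eq_norm, Prod.dist_eq, dist_self, max_eq_right dist_nonneg] at this
    exact this
  have hBd : ∀ n ≥ n₀, ‖B₀ n + B₁ n (cd d)‖ ≤ D₁' + D₂' := fun n hn =>
    (norm_add_le _ _).trans (add_le_add ((norm_comp_inr_le _).trans (he₁ n hn).2.2)
      ((norm_comp_inl_le _).trans (he₂ n hn).2.2))
  obtain ⟨ε, hε, hεS, C', n₁, hn₁, hsol⟩ :=
    exists_unique_zero_of_perturbation hA hA0 hSn hB hBd hρ hρ₁
  have hiff : ∀ n ≥ n₁, ∀ z ∈ cd.source, cd z ∈ Metric.closedBall (cd d) ε →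
      (DiscreteEulerLagrange E (Fn n) a b z ↔
        A₀ + A₁ (cd z) + ρ ^ n • (B₀ n + B₁ n (cd z)) = 0) := by
    intro n hn z hz hzε
    have hn' : n ≥ n₀ := hn₁.trans hn
    have hzS := hεS hzε
    have h1 := hfd n a b (α, β) hFab ((he₁ n hn').1.differentiableAt (Metric.ball_mem_nhds _ hr₁))
    have h2 := hfd n b d (β, cd z) hzS.2.2 ((he₂ n hn').1.differentiableAt
      (Metric.isOpen_ball.mem_nhds (hmem _ hzS.1)))
    unfold DiscreteEulerLagrange
    rw [D₂_eq (E := E) (F := Fn n) (b := b) (mem_extChartAt_source (I := 𝓘(ℝ, E)) a)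
      h1.differentiableAt, D₁_eq (E := E) (F := Fn n) (a := b) hz h2.differentiableAt,
      h1.fderiv, h2.fderiv]
    simp only [hA₀, hA₁, hB₀, hB₁, ContinuousLinearMap.add_comp, ContinuousLinearMap.smul_comp,
      smul_add]
    rw [add_add_add_comm]
  refine ⟨cd.source ∩ cd ⁻¹' Metric.closedBall (cd d) ε,
    inter_mem (extChartAt_source_mem_nhds d)
      ((continuousAt_extChartAt d).preimage_mem_nhds (Metric.closedBall_mem_nhds _ hε)),
    C', n₁, fun n hn => ?_⟩
  obtain ⟨v, hv, hv0, huniq, hbound⟩ := hsol n hn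
  have hvt : v ∈ cd.target := (hεS hv).2.1
  have hcv : cd (cd.symm v) = v := cd.right_inv hvt
  have hvs : cd.symm v ∈ cd.source := cd.map_target hvt
  refine ⟨cd.symm v, ⟨hvs, by rwa [mem_preimage, hcv]⟩, ?_, fun z hz hzD => ?_, by rwa [hcv]⟩
  · exact (hiff n hn _ hvs (by rwa [hcv])).2 (by rwa [hcv])
  · rw [← huniq (cd z) hz.2 ((hiff n hn z hz.1 hz.2).1 hzD), cd.left_inv hz.1]

end Charts
-- The exact flow solves the exact discrete equations
section ExactDiscreteLagrangian

variable {E : Type*} [NormedAddCommGroup E] [InnerProductSpace ℝ E]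
  {G : Type*} [TopologicalSpace G] [ChartedSpace E G] [Group G] [LieGroup 𝓘(ℝ, E) ∞ G]

/-- A variation with fixed endpoints of a curve on `[0, 2h]` whose value at time `h` moves along a
straight line in the chart. -/
theorem exists_variation_through {h : ℝ} (hh : 0 < h) {q : ℝ → G}
    (hq : IsC2Curve E (2 * h) q) (v : E) :
    ∃ Γ : ℝ → ℝ → G, IsVariation E (2 * h) q Γ ∧
      (∀ t, Γ 0 t = q t) ∧
      (∀ s, Γ s h = (extChartAt 𝓘(ℝ, E) (q h)).symm (extChartAt 𝓘(ℝ, E) (q h) (q h) + s • v)) ∧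
      (∀ s, Γ s 0 = q 0 ∧ Γ s (2 * h) = q (2 * h)) ∧
      ∀ᶠ s in 𝓝 (0 : ℝ), IsC2Curve E (2 * h) (Γ s) := by
  set κ := extChartAt 𝓘(ℝ, E) (q h) with hκ
  -- A parabola that vanishes at `0` and `2h` and has its maximum `1` at `h`.
  set χ : ℝ → ℝ := fun t => t * (2 * h - t) / h ^ 2 with hχ
  have hχ_mem : ∀ t ∈ Icc 0 (2 * h), |χ t| ≤ 1 := by
    intro t ht
    have h1 : 0 ≤ t * (2 * h - t) := mul_nonneg ht.1 (by linarith [ht.2])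
    rw [abs_of_nonneg (by positivity), div_le_one (by positivity)]
    nlinarith [sq_nonneg (t - h)]
  obtain ⟨r, hr, hrt⟩ := Metric.mem_nhds_iff.1 (extChartAt_target_mem_nhds (I := 𝓘(ℝ, E)) (q h))
  set ε : ℝ := r / (‖v‖ + 1) with hε
  have hv : 0 < ‖v‖ + 1 := by positivity
  have hε0 : 0 < ε := by positivity
  have htarget : ∀ s ∈ Ioo (-ε) ε, ∀ t ∈ Icc 0 (2 * h), κ (q h) + (s * χ t) • v ∈ κ.target := by
    intro s hs t ht
    refine hrt ?_
    rw [Metric.mem_ball, dist_self_add_left, norm_smul, norm_mul, Real.norm_eq_abs,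
      Real.norm_eq_abs]
    calc |s| * |χ t| * ‖v‖ ≤ |s| * 1 * (‖v‖ + 1) := by
          gcongr
          · exact hχ_mem t ht
          · linarith
      _ < ε * (‖v‖ + 1) := by rw [mul_one]; gcongr; exact abs_lt.2 hs
      _ = r := by rw [hε]; field_simp
  -- Left multiplication by a group element near the identity moves `q t`, so the curve need not lie
  -- in one chart. The factor is the identity when `s * χ t = 0`, and at `t = h` it carries `q h` to
  -- the prescribed point.
  set Γ : ℝ → ℝ → G := fun s t => κ.symm (κ (q h) + (s * χ t) • v) * (q h)⁻¹ * q t with hΓ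
  have hκ0 : κ.symm (κ (q h)) = q h := extChartAt_to_inv (I := 𝓘(ℝ, E)) (q h)
  have hΓ0 : ∀ t, Γ 0 t = q t := fun t => by simp [hΓ, hκ0]
  have hend : ∀ s, Γ s 0 = q 0 ∧ Γ s (2 * h) = q (2 * h) := fun s => by simp [hΓ, hχ, hκ0]
  have hχh : χ h = 1 := by simp only [hχ]; field_simp; ring
  have hΓ2 : ContMDiffOn 𝓘(ℝ, ℝ × ℝ) 𝓘(ℝ, E) 2 (fun p : ℝ × ℝ => Γ p.1 p.2)
      (Ioo (-ε) ε ×ˢ Icc 0 (2 * h)) := by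
    have : ContMDiffMul 𝓘(ℝ, E) 2 G := ContMDiffMul.of_le ENat.LEInfty.out
    have h1 : ContMDiff 𝓘(ℝ, ℝ × ℝ) 𝓘(ℝ, E) 2
        (fun p : ℝ × ℝ => κ (q h) + (p.1 * χ p.2) • v) := by
      refine ContDiff.contMDiff ?_
      simp only [hχ]
      fun_prop
    have h2 : ContMDiffOn 𝓘(ℝ, ℝ × ℝ) 𝓘(ℝ, E) 2
        (fun p : ℝ × ℝ => κ.symm (κ (q h) + (p.1 * χ p.2) • v)) (Ioo (-ε) ε ×ˢ Icc 0 (2 * h)) :=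
      (contMDiffOn_extChartAt_symm (q h)).comp h1.contMDiffOn
        fun p hp => htarget _ hp.1 _ hp.2
    have h3 : ContMDiffOn 𝓘(ℝ, ℝ × ℝ) 𝓘(ℝ, E) 2 (fun p : ℝ × ℝ => q p.2)
        (Ioo (-ε) ε ×ˢ Icc 0 (2 * h)) :=
      ContMDiffOn.comp (g := q) (f := fun p : ℝ × ℝ => p.2) (t := Icc 0 (2 * h)) hq
        contDiff_snd.contMDiff.contMDiffOn fun p hp => hp.2
    exact (h2.mul contMDiffOn_const).mul h3
  refine ⟨Γ, ⟨ε, hε0, hΓ2, fun t _ => hΓ0 t, fun s _ => hend s⟩, hΓ0, fun s => ?_, hend, ?_⟩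
  · simp [hΓ, hχh]
  · filter_upwards [Ioo_mem_nhds (neg_neg_of_pos hε0) hε0] with s hs
    exact hΓ2.comp (f := fun t : ℝ => (s, t)) (contDiff_prodMk_right s).contMDiff.contMDiffOn
      fun t ht => ⟨hs, ht⟩

/-- A function of the endpoints that bounds the action from below, with equality along a solution of
the Euler-Lagrange equations, satisfies the discrete Euler-Lagrange equations along that solution. -/
theorem discreteEulerLagrange_of_le_action {L : TangentBundle 𝓘(ℝ, E) G → ℝ} (hL : Continuous L)
    {h : ℝ} (hh : 0 < h) {q : ℝ → G} (hq : SolvesEulerLagrange L (2 * h) q) {F : G → G → ℝ}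
    (hle₁ : ∀ᶠ x in 𝓝 (q h), ∀ k : ℝ → G, IsC2Curve E h k → k 0 = q 0 → k h = x →
      F (q 0) x ≤ action L h k)
    (hle₂ : ∀ᶠ x in 𝓝 (q h), ∀ k : ℝ → G, IsC2Curve E h k → k 0 = x → k h = q (2 * h) →
      F x (q (2 * h)) ≤ action L h k)
    (heq₁ : F (q 0) (q h) = action L h q)
    (heq₂ : F (q h) (q (2 * h)) = action L h (fun t => q (h + t)))
    (hd₁ : DifferentiableAt ℝ (localRep F (q 0) (q h))
      (extChartAt 𝓘(ℝ, E) (q 0) (q 0), extChartAt 𝓘(ℝ, E) (q h) (q h)))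
    (hd₂ : DifferentiableAt ℝ (localRep F (q h) (q (2 * h)))
      (extChartAt 𝓘(ℝ, E) (q h) (q h), extChartAt 𝓘(ℝ, E) (q (2 * h)) (q (2 * h)))) :
    DiscreteEulerLagrange E F (q 0) (q h) (q (2 * h)) := by
  have hsplit : ∀ k : ℝ → G, IsC2Curve E (2 * h) k →
      action L (2 * h) k = action L h k + action L h (fun t => k (h + t)) := fun k hk => by
    have : IsManifold 𝓘(ℝ, E) 1 G := IsManifold.of_le (n := ∞) (by simp)
    have := action_eq_add_shift hL hh (by linarith : h < 2 * h) hk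
    rwa [show 2 * h - h = h by ring] at this
  unfold DiscreteEulerLagrange
  rw [D₂_eq (E := E) (mem_extChartAt_source (I := 𝓘(ℝ, E)) (q 0)) hd₁,
    D₁_eq (E := E) (mem_extChartAt_source (I := 𝓘(ℝ, E)) (q (2 * h))) hd₂]
  ext v
  obtain ⟨Γ, hΓ, hΓ0, hΓh, hΓend, hΓ2⟩ := exists_variation_through hh hq.1 v
  set β := extChartAt 𝓘(ℝ, E) (q h) (q h) with hβ
  have hline : HasDerivAt (fun s : ℝ => β + s • v) v 0 := by
    simpa using ((hasDerivAt_id (0 : ℝ)).smul_const v).const_add β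
  have hline0 : β + (0 : ℝ) • v = β := by simp
  have hs₁ : HasDerivAt (fun s => F (q 0) (Γ s h))
      (fderiv ℝ (localRep F (q 0) (q h)) (extChartAt 𝓘(ℝ, E) (q 0) (q 0), β) (0, v)) 0 := by
    have h1 := HasDerivAt.prodMk (hasDerivAt_const (0 : ℝ) (extChartAt 𝓘(ℝ, E) (q 0) (q 0))) hline
    have h2 := HasFDerivAt.comp_hasDerivAt_of_eq (0 : ℝ) hd₁.hasFDerivAt h1 (by simp)
    refine h2.congr_of_eventuallyEq (Eventually.of_forall fun s => ?_)
    simp only [Function.comp, localRep, hΓh, extChartAt_to_inv]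
  have hs₂ : HasDerivAt (fun s => F (Γ s h) (q (2 * h)))
      (fderiv ℝ (localRep F (q h) (q (2 * h)))
        (β, extChartAt 𝓘(ℝ, E) (q (2 * h)) (q (2 * h))) (v, 0)) 0 := by
    have h1 := HasDerivAt.prodMk hline
      (hasDerivAt_const (0 : ℝ) (extChartAt 𝓘(ℝ, E) (q (2 * h)) (q (2 * h))))
    have h2 := HasFDerivAt.comp_hasDerivAt_of_eq (0 : ℝ) hd₂.hasFDerivAt h1 (by simp)
    refine h2.congr_of_eventuallyEq (Eventually.of_forall fun s => ?_)
    simp only [Function.comp, localRep, hΓh, extChartAt_to_inv]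
  have hf := ((hq.2 Γ hΓ).sub hs₁).sub hs₂
  have hΓcont : ContinuousAt (fun s => Γ s h) 0 := by
    simp only [hΓh]
    refine ContinuousAt.comp_of_eq (g := (extChartAt 𝓘(ℝ, E) (q h)).symm)
      (continuousAt_extChartAt_symm (q h)) hline.continuousAt hline0
  have hlim : Tendsto (fun s => Γ s h) (𝓝 0) (𝓝 (q h)) := by
    have := hΓcont.tendsto
    rwa [hΓ0] at this
  have hΓ0' : Γ 0 = q := funext hΓ0
  -- Each half of the varied curve competes in one of the two lower bounds, and both are equalities
  -- at `s = 0`. Only `F` is differentiated, so no smooth dependence of the minimizers on their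
  -- endpoints is needed.
  have hmin : IsLocalMin (fun s => action L (2 * h) (Γ s) - F (q 0) (Γ s h) -
      F (Γ s h) (q (2 * h))) 0 := by
    filter_upwards [hΓ2, hlim.eventually hle₁, hlim.eventually hle₂] with s hs h1 h2
    have hz : action L (2 * h) (Γ 0) - F (q 0) (Γ 0 h) - F (Γ 0 h) (q (2 * h)) = 0 := by
      rw [hΓ0', hsplit q hq.1, heq₁, heq₂]; ring
    have i1 := h1 (Γ s) (hs.restrict (by linarith)) (hΓend s).1 rfl
    have hshift : IsC2Curve E h (fun t => Γ s (h + t)) := by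
      have := hs.shift hh.le
      rwa [show 2 * h - h = h by ring] at this
    have i2 := h2 (fun t => Γ s (h + t)) hshift (by simp)
      (by rw [show h + h = 2 * h by ring]; exact (hΓend s).2)
    rw [hz, hsplit (Γ s) hs]
    linarith
  have hfin := hmin.hasDerivAt_eq_zero hf
  simp only [add_apply, ContinuousLinearMap.comp_apply,
    ContinuousLinearMap.inl_apply, ContinuousLinearMap.inr_apply, zero_apply]
  linarith

end ExactDiscreteLagrangian
end LieGalerkin

/-! ### The main theorem -/

open LieGalerkin in
theorem mainTheorem2
    {E : Type*} [NormedAddCommGroup E] [InnerProductSpace ℝ E] [FiniteDimensional ℝ E]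
    {G : Type*} [TopologicalSpace G] [ChartedSpace E G] [Group G] [LieGroup 𝓘(ℝ, E) ∞ G]
    -- the Lagrangian and the time step
    (L : TangentBundle 𝓘(ℝ, E) G → ℝ) (hL : ContMDiff 𝓘(ℝ, E).tangent 𝓘(ℝ, ℝ) 2 L)
    (h : ℝ) (hh : 0 < h)
    -- the natural chart: a local diffeomorphism from the Lie algebra, used on the open set `U`
    (Φ : E → G) (U : Set E) (hU : IsOpen U)
    (hΦ : IsLocalDiffeomorphOn 𝓘(ℝ, E) 𝓘(ℝ, E) ∞ Φ U)
    -- approximation spaces and quadrature rules, for every `n`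
    (φ : (n : ℕ) → Fin n → ℝ → ℝ) (hφ : ∀ n i, ContDiffOn ℝ 2 (φ n i) (Icc 0 h))
    (m : ℕ → ℕ) (b c : (n : ℕ) → Fin (m n) → ℝ) (hc : ∀ n j, c n j ∈ Icc (0 : ℝ) 1)
    -- pairs of endpoints, and the part of `TG` on which the error is measured
    (W : Set (G × G)) (V : Set (TangentBundle 𝓘(ℝ, E) G)) (n₀ : ℕ)
    -- the exact solutions `g₀ Φ(ξ g₀ g₁)` of the Euler-Lagrange equations
    (ξ : G → G → ℝ → E)
    (hξ : ∀ g₀ g₁, (g₀, g₁) ∈ W →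
      ContDiffOn ℝ 2 (ξ g₀ g₁) (Icc 0 h) ∧ MapsTo (ξ g₀ g₁) (Icc 0 h) U ∧
      chartCurve Φ g₀ (ξ g₀ g₁) 0 = g₀ ∧ chartCurve Φ g₀ (ξ g₀ g₁) h = g₁ ∧
      SolvesEulerLagrange L h (chartCurve Φ g₀ (ξ g₀ g₁)) ∧
      ∀ t ∈ Icc 0 h, lift E h (chartCurve Φ g₀ (ξ g₀ g₁)) t ∈ V)
    -- the extremizing Galerkin curves `g₀ Φ(ξg n g₀ g₁)`
    (ξg : ℕ → G → G → ℝ → E)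
    (hξg : ∀ n ≥ n₀, ∀ g₀ g₁, (g₀, g₁) ∈ W →
      IsDiscreteExtremal L Φ U h (φ n) (b n) (c n) g₀ g₁ (ξg n g₀ g₁))
    -- (1) approximation
    (CA CA₁ K : ℝ) (hCA : 0 ≤ CA) (hCA₁ : 0 ≤ CA₁) (hK : 0 < K) (hK₁ : K < 1)
    (happrox : ∀ n ≥ n₀, ∀ g₀ g₁, (g₀, g₁) ∈ W →
      ∃ η ∈ admissibleBetween Φ U h (φ n) g₀ g₁, ∀ t ∈ Icc 0 h,
        lift E h (chartCurve Φ g₀ η) t ∈ V ∧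
        ‖ξ g₀ g₁ t - η t‖ ≤ CA * K ^ n ∧
        ‖derivWithin (ξ g₀ g₁) (Icc 0 h) t - derivWithin η (Icc 0 h) t‖ ≤ CA₁ * K ^ n)
    -- (2) the Lagrangian is Lipschitz in the error functions
    (eG : G → G → ℝ) (eA : TangentBundle 𝓘(ℝ, E) G → TangentBundle 𝓘(ℝ, E) G → ℝ)
    (CL : ℝ) (hCL : 0 ≤ CL)
    (hLip : ∀ v ∈ V, ∀ w ∈ V, |L v - L w| ≤ CL * (eG v.proj w.proj + eA v w))
    -- (3) the natural chart is well conditioned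
    (CG CV CVG : ℝ) (hCG : 0 ≤ CG) (hCV : 0 ≤ CV) (hCVG : 0 ≤ CVG)
    (hcond : ∀ g₀ ∈ Prod.fst '' W, ∀ ζ η : ℝ → E,
      ContDiffOn ℝ 2 ζ (Icc 0 h) → ContDiffOn ℝ 2 η (Icc 0 h) →
      MapsTo ζ (Icc 0 h) U → MapsTo η (Icc 0 h) U →
      (∀ t ∈ Icc 0 h, lift E h (chartCurve Φ g₀ ζ) t ∈ V) →
      (∀ t ∈ Icc 0 h, lift E h (chartCurve Φ g₀ η) t ∈ V) →
      ∀ t ∈ Icc 0 h,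
        eG (chartCurve Φ g₀ ζ t) (chartCurve Φ g₀ η t) ≤ CG * ‖ζ t - η t‖ ∧
        eA (lift E h (chartCurve Φ g₀ ζ) t) (lift E h (chartCurve Φ g₀ η) t) ≤
          CV * ‖derivWithin ζ (Icc 0 h) t - derivWithin η (Icc 0 h) t‖ + CVG * ‖ζ t - η t‖)
    -- (4) quadrature
    (CQ Kq : ℝ) (hCQ : 0 ≤ CQ) (hKq : 0 < Kq) (hKq₁ : Kq < 1)
    (hquad : ∀ n ≥ n₀, ∀ g₀ ∈ Prod.fst '' W, ∀ η ∈ admissible U h (φ n),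
      |action L h (chartCurve Φ g₀ η) - discreteAction L h (b n) (c n) (chartCurve Φ g₀ η)|
        ≤ CQ * Kq ^ n)
    -- (5) the stationary points are minimizers
    (hmin : ∀ g₀ g₁, (g₀, g₁) ∈ W → MinimizesAction L h (chartCurve Φ g₀ (ξ g₀ g₁)))
    (hminD : ∀ n ≥ n₀, ∀ g₀ g₁, (g₀, g₁) ∈ W →
      MinimizesDiscreteAction L Φ U h (φ n) (b n) (c n) g₀ g₁ (ξg n g₀ g₁)) :
    -- the Galerkin discrete Lagrangians converge geometrically to the exact one
    (∃ C : ℝ, ∀ n ≥ n₀, ∀ g₀ g₁, (g₀, g₁) ∈ W →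
      |exactLd L Φ h ξ g₀ g₁ - galerkinLd L Φ h (b n) (c n) (ξg n) g₀ g₁| ≤ C * max K Kq ^ n) ∧
    -- the induced variational integrators converge geometrically to the exact flow
    (∀ q : ℝ → G, SolvesEulerLagrange L (2 * h) q →
      (q 0, q h) ∈ interior W → (q h, q (2 * h)) ∈ interior W →
      (∀ t ∈ Icc 0 h, chartCurve Φ (q 0) (ξ (q 0) (q h)) t = q t) →
      (∀ t ∈ Icc 0 h, chartCurve Φ (q h) (ξ (q h) (q (2 * h))) t = q (h + t)) →
      ContMDiffAt (𝓘(ℝ, E).prod 𝓘(ℝ, E)) 𝓘(ℝ, ℝ) 2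
        (fun p : G × G => exactLd L Φ h ξ p.1 p.2) (q 0, q h) →
      ContMDiffAt (𝓘(ℝ, E).prod 𝓘(ℝ, E)) 𝓘(ℝ, ℝ) 2
        (fun p : G × G => exactLd L Φ h ξ p.1 p.2) (q h, q (2 * h)) →
      IsRegularAt E (exactLd L Φ h ξ) (q h) (q (2 * h)) →
      UniformlyC11At E n₀ (remainder (exactLd L Φ h ξ)
        (fun n => galerkinLd L Φ h (b n) (c n) (ξg n)) (max K Kq)) (q 0) (q h) →
      UniformlyC11At E n₀ (remainder (exactLd L Φ h ξ)
        (fun n => galerkinLd L Φ h (b n) (c n) (ξg n)) (max K Kq)) (q h) (q (2 * h)) →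
      ∃ N ∈ 𝓝 (q (2 * h)), ∃ C : ℝ, ∃ n₁ : ℕ, ∀ n ≥ n₁, ∃ y ∈ N,
        DiscreteEulerLagrange E (galerkinLd L Φ h (b n) (c n) (ξg n)) (q 0) (q h) y ∧
        (∀ z ∈ N, DiscreteEulerLagrange E (galerkinLd L Φ h (b n) (c n) (ξg n)) (q 0) (q h) z →
          z = y) ∧
        ‖extChartAt 𝓘(ℝ, E) (q (2 * h)) y - extChartAt 𝓘(ℝ, E) (q (2 * h)) (q (2 * h))‖
          ≤ C * max K Kq ^ n) := by
  have hLc : Continuous L := hL.continuous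
  have hcurve : ∀ g₀ g₁, (g₀, g₁) ∈ W → IsC2Curve E h (chartCurve Φ g₀ (ξ g₀ g₁)) :=
    fun g₀ g₁ hW => (hξ g₀ g₁ hW).2.2.2.2.1.1
  have hadm : ∀ n (g₀ : G), ∀ η ∈ admissible U h (φ n), IsC2Curve E h (chartCurve Φ g₀ η) :=
    fun n g₀ η hη => isC2Curve_chartCurve hΦ g₀ (contDiffOn_of_mem_algSpace (hφ n) hη.1) hη.2
  have hρ : 0 < max K Kq := lt_max_of_lt_left hK
  have hρ₁ : max K Kq < 1 := max_lt hK₁ hKq₁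
  have hKρ : ∀ n : ℕ, K ^ n ≤ max K Kq ^ n := fun n => by gcongr; exact le_max_left _ _
  have hKqρ : ∀ n : ℕ, Kq ^ n ≤ max K Kq ^ n := fun n => by gcongr; exact le_max_right _ _
  have hexact_le : ∀ g₀ g₁, (g₀, g₁) ∈ W → ∀ k : ℝ → G, IsC2Curve E h k → k 0 = g₀ → k h = g₁ →
      exactLd L Φ h ξ g₀ g₁ ≤ action L h k := by
    intro g₀ g₁ hW k hk h0 h1
    obtain ⟨-, -, e0, e1, -, -⟩ := hξ g₀ g₁ hW
    exact hmin g₀ g₁ hW k hk (h0.trans e0.symm) (h1.trans e1.symm)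
  -- `B * K ^ n` bounds the pointwise difference of the Lagrangian along the exact curve and its
  -- approximation: conditions (1) and (3) inserted into (2).
  set B : ℝ := CL * (CG * CA + (CV * CA₁ + CVG * CA)) with hB
  have hB0 : 0 ≤ B := by positivity
  have hconv : ∀ n ≥ n₀, ∀ g₀ g₁, (g₀, g₁) ∈ W →
      |exactLd L Φ h ξ g₀ g₁ - galerkinLd L Φ h (b n) (c n) (ξg n) g₀ g₁|
        ≤ (B * h + CQ) * max K Kq ^ n := by
    intro n hn g₀ g₁ hW
    have hW₁ : g₀ ∈ Prod.fst '' W := ⟨(g₀, g₁), hW, rfl⟩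
    obtain ⟨hξ2, hξU, e0, e1, -, hξV⟩ := hξ g₀ g₁ hW
    have hCQ' : CQ * Kq ^ n ≤ CQ * max K Kq ^ n := mul_le_mul_of_nonneg_left (hKqρ n) hCQ
    have hBh : 0 ≤ B * h * max K Kq ^ n := by positivity
    rw [abs_le]
    constructor
    -- Upper bound for `galerkinLd`: the approximating curve competes in the discrete minimization.
    · obtain ⟨η, hη, hηt⟩ := happrox n hn g₀ g₁ hW
      have hη2 := contDiffOn_of_mem_algSpace (hφ n) hη.1.1
      have hdiff : |action L h (chartCurve Φ g₀ (ξ g₀ g₁)) - action L h (chartCurve Φ g₀ η)|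
          ≤ B * K ^ n * h := by
        refine action_sub_le hLc hh (hcurve g₀ g₁ hW) (hadm n g₀ η hη.1) fun t ht => ?_
        obtain ⟨hηV, hclose, hclose'⟩ := hηt t ht
        obtain ⟨hG, hA⟩ := hcond g₀ hW₁ _ η hξ2 hη2 hξU hη.1.2 hξV (fun s hs => (hηt s hs).1) t ht
        refine (hLip _ (hξV t ht) _ hηV).trans ?_
        have hG' : eG (chartCurve Φ g₀ (ξ g₀ g₁) t) (chartCurve Φ g₀ η t) ≤ CG * (CA * K ^ n) :=
          hG.trans (by gcongr)
        have hA' : eA (lift E h (chartCurve Φ g₀ (ξ g₀ g₁)) t) (lift E h (chartCurve Φ g₀ η) t) ≤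
            CV * (CA₁ * K ^ n) + CVG * (CA * K ^ n) := hA.trans (by gcongr)
        calc _ ≤ CL * (CG * (CA * K ^ n) + (CV * (CA₁ * K ^ n) + CVG * (CA * K ^ n))) :=
              mul_le_mul_of_nonneg_left (add_le_add hG' hA') hCL
          _ = B * K ^ n := by rw [hB]; ring
      have hq := hquad n hn g₀ hW₁ η hη.1
      have hm : galerkinLd L Φ h (b n) (c n) (ξg n) g₀ g₁ ≤
          discreteAction L h (b n) (c n) (chartCurve Φ g₀ η) := hminD n hn g₀ g₁ hW η hη
      have hBK : B * K ^ n * h ≤ B * h * max K Kq ^ n := by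
        rw [mul_right_comm]
        exact mul_le_mul_of_nonneg_left (hKρ n) (by positivity)
      have hdiff' : |exactLd L Φ h ξ g₀ g₁ - action L h (chartCurve Φ g₀ η)|
          ≤ B * K ^ n * h := hdiff
      rw [abs_le] at hq hdiff'
      rw [add_mul]
      linarith [hq.1, hq.2, hdiff'.1, hdiff'.2]
    -- Upper bound for `exactLd`: the Galerkin curve competes in the continuous minimization, so
    -- only the quadrature error enters.
    · obtain ⟨⟨hadmg, g0, g1⟩, -⟩ := hξg n hn g₀ g₁ hW
      have hm := hexact_le g₀ g₁ hW _ (hadm n g₀ _ hadmg) g0 g1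
      have hq : |action L h (chartCurve Φ g₀ (ξg n g₀ g₁)) -
          galerkinLd L Φ h (b n) (c n) (ξg n) g₀ g₁| ≤ CQ * Kq ^ n :=
        hquad n hn g₀ hW₁ _ hadmg
      rw [abs_le] at hq
      rw [add_mul]
      linarith [hq.1, hq.2]
  refine ⟨⟨_, hconv⟩, fun q hq hW₁ hW₂ hq₁ hq₂ hC₁ hC₂ hreg he₁ he₂ => ?_⟩
  have hrem : ∀ n ≥ n₀, ∀ g₀ g₁, (g₀, g₁) ∈ W → |remainder (exactLd L Φ h ξ)
      (fun n => galerkinLd L Φ h (b n) (c n) (ξg n)) (max K Kq) n g₀ g₁| ≤ B * h + CQ := by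
    intro n hn g₀ g₁ hW
    rw [remainder, abs_div, abs_of_pos (pow_pos hρ n), div_le_iff₀ (pow_pos hρ n), abs_sub_comm]
    exact hconv n hn g₀ g₁ hW
  have hC₁' := contDiffAt_localRep hC₁
  have hC₂' := contDiffAt_localRep hC₂
  have hDEL : DiscreteEulerLagrange E (exactLd L Φ h ξ) (q 0) (q h) (q (2 * h)) := by
    refine discreteEulerLagrange_of_le_action hLc hh hq ?_ ?_ (action_congr hh.le hq₁)
      (action_congr hh.le hq₂) (hC₁'.differentiableAt (by norm_num))
      (hC₂'.differentiableAt (by norm_num))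
    -- Interiority in `W` keeps the pair in `W` when the middle point moves, so the exact minimality
    -- still applies there.
    · filter_upwards [(Continuous.prodMk_right (q 0)).continuousAt.eventually
        (mem_interior_iff_mem_nhds.1 hW₁)] with x hx using hexact_le _ _ hx
    · filter_upwards [(Continuous.prodMk_left (q (2 * h))).continuousAt.eventually
        (mem_interior_iff_mem_nhds.1 hW₂)] with x hx using hexact_le _ _ hx
  refine exists_unique_discreteEulerLagrange hρ hρ₁ hC₁' hC₂' hDEL hreg he₁ he₂
    (C := B * h + CQ) ?_ ?_
  · filter_upwards [mem_interior_iff_mem_nhds.1 hW₁] with p hp n hn using hrem n hn _ _ hp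
  · filter_upwards [mem_interior_iff_mem_nhds.1 hW₂] with p hp n hn using hrem n hn _ _ hp
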